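/- Let $V$ be a countable set of propositional variables, and let formulas be built from $V$ and the constant $\bot$ with $\wedge$, $\to$, $\Box$, $\Diamond$. Put $\top := \bot\to\bot$, $\neg\varphi := \varphi\to\bot$ and $\varphi\vee\psi := ((\varphi\to\psi)\to\psi)\wedge((\psi\to\varphi)\to\varphi)$. The logic $K45(\mathbf G)$ has as axioms all instances of the following schemes. Gödel propositional logic: $(\varphi\to\psi)\to((\psi\to\chi)\to(\varphi\to\chi))$; $(\varphi\wedge\psi)\to\varphi$; $(\varphi\wedge\psi)\to(\psi\wedge\varphi)$; $(\varphi\to(\psi\to\chi))\to((\varphi\wedge\psi)\to\chi)$; $((\varphi\wedge\psi)\to\chi)\to(\varphi\to(\psi\to\chi))$; $\varphi\to(\varphi\wedge\varphi)$; $((\varphi\to\psi)\to\chi)\to(((\psi\to\varphi)\to\chi)\to\chi)$; $\bot\to\varphi$. Gödel modal logic $K(\mathbf G)$: $\Box(\varphi\to\psi)\to(\Box\varphi\to\Box\psi)$; $\Diamond(\varphi\vee\psi)\to(\Diamond\varphi\vee\Diamond\psi)$; $\Box\top$; $\neg\Diamond\bot$; $\Box(\varphi\to\psi)\to(\Diamond\varphi\to\Diamond\psi)$;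 $(\Diamond\varphi\to\Box\psi)\to\Box(\varphi\to\psi)$. Axioms 4 and 5: $\Box\varphi\to\Box\Box\varphi$; $\Diamond\Diamond\varphi\to\Diamond\varphi$; $\Diamond\Box\varphi\to\Box\varphi$; $\Diamond\varphi\to\Box\Diamond\varphi$. Its rules are modus ponens and necessitation (from $\varphi$ infer $\Box\varphi$). For a set $T$ of formulas, $T\vdash_{K45(\mathbf G)}\varphi$ means that $\varphi$ is derivable from the axioms and the formulas of $T$ by these rules, where necessitation may be applied only to theorems (formulas derivable from no assumptions). A possibilistic Gödel Kripke model is a triple $\langle W,\pi,e\rangle$ with $W$ a non-empty set, $\pi:W\to[0,1]$ (not necessarily normalised) and $e:W\times V\to[0,1]$. With $a\Rightarrow b := 1$ if $a\le b$ and $a\Rightarrow b := b$ otherwise, $e$ extends to all formulas by $e(w,\bot)=0$, $e(w,\varphi\wedge\psi)=\min(e(w,\varphi),e(w,\psi))$, $e(w,\varphi\to\psi)=e(w,\varphi)\Rightarrow e(w,\psi)$, $e(w,\Box\varphi)=\inf_{w'\in W}(\pi(w')\Rightarrow e(w',\varphi))$ and $e(w,\Diamond\varphi)=\sup_{w'\in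 W}\min(\pi(w'),e(w',\varphi))$. Write $T\models_{\Pi\mathcal G}\varphi$ if for every such model and every $w\in W$: if $e(w,\psi)=1$ for all $\psi\in T$, then $e(w,\varphi)=1$. Theorem (finite strong completeness of $K45(\mathbf G)$). For every finite set $T$ of formulas and every formula $\varphi$, $$T\models_{\Pi\mathcal G}\varphi\quad\text{if and only if}\quad T\vdash_{K45(\mathbf G)}\varphi .$$ -/

import Mathlib

open unitInterval

universe u w

namespace GodelModal

/-- Formulas of the bimodal Goedel language over a set `V` of propositional variables:
primitive symbols are `⊥`, `∧`, `→`, `□`, `◇`. -/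
inductive Formula (V : Type u) : Type u
  | var (p : V) : Formula V
  | bot : Formula V
  | and (φ ψ : Formula V) : Formula V
  | imp (φ ψ : Formula V) : Formula V
  | box (φ : Formula V) : Formula V
  | dia (φ : Formula V) : Formula V

namespace Formula

variable {V : Type u}

/-- `⊤` is `⊥ → ⊥`. -/
def top : Formula V := imp bot bot

/-- `¬φ` is `φ → ⊥`. -/
def neg (φ : Formula V) : Formula V := imp φ bot

/-- `φ ∨ ψ` is `((φ → ψ) → ψ) ∧ ((ψ → φ) → φ)`. -/
def or (φ ψ : Formula V) : Formula V :=
  and (imp (imp φ ψ) ψ) (imp (imp ψ φ) φ)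

end Formula

open Formula

/-- The axioms of the logic `K45(G)`. -/
inductive AxiomK45 {V : Type u} : Formula V → Prop
  -- axioms of propositional Goedel logic
  | a1 (φ ψ χ : Formula V) : AxiomK45 (imp (imp φ ψ) (imp (imp ψ χ) (imp φ χ)))
  | a2 (φ ψ : Formula V) : AxiomK45 (imp (and φ ψ) φ)
  | a3 (φ ψ : Formula V) : AxiomK45 (imp (and φ ψ) (and ψ φ))
  | a4a (φ ψ χ : Formula V) : AxiomK45 (imp (imp φ (imp ψ χ)) (imp (and φ ψ) χ))
  | a4b (φ ψ χ : Formula V) : AxiomK45 (imp (imp (and φ ψ) χ) (imp φ (imp ψ χ)))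
  | a6 (φ : Formula V) : AxiomK45 (imp φ (and φ φ))
  | a7 (φ ψ χ : Formula V) :
      AxiomK45 (imp (imp (imp φ ψ) χ) (imp (imp (imp ψ φ) χ) χ))
  | a8 (φ : Formula V) : AxiomK45 (imp bot φ)
  -- axioms of the minimal Goedel modal logic `K(G)`
  | kBox (φ ψ : Formula V) :
      AxiomK45 (imp (box (imp φ ψ)) (imp (box φ) (box ψ)))
  | kDia (φ ψ : Formula V) :
      AxiomK45 (imp (dia (or φ ψ)) (or (dia φ) (dia ψ)))
  | fBox : AxiomK45 (box top)
  | fDia : AxiomK45 (neg (dia bot))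
  | p (φ ψ : Formula V) :
      AxiomK45 (imp (box (imp φ ψ)) (imp (dia φ) (dia ψ)))
  | fs2 (φ ψ : Formula V) :
      AxiomK45 (imp (imp (dia φ) (box ψ)) (box (imp φ ψ)))
  -- the axioms 4 and 5 for both modalities
  | fourBox (φ : Formula V) : AxiomK45 (imp (box φ) (box (box φ)))
  | fourDia (φ : Formula V) : AxiomK45 (imp (dia (dia φ)) (dia φ))
  | fiveBox (φ : Formula V) : AxiomK45 (imp (dia (box φ)) (box φ))
  | fiveDia (φ : Formula V) : AxiomK45 (imp (dia φ) (box (dia φ)))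

/-- `DerivesK45 T φ` is `T ⊢ φ` in `K45(G)`: derivability from the assumptions `T` by modus
ponens and necessitation, where necessitation may be applied only to theorems, that is, to
formulas derived from no assumptions. -/
inductive DerivesK45 {V : Type u} : Set (Formula V) → Formula V → Prop
  | ax {T : Set (Formula V)} {φ : Formula V} (h : AxiomK45 φ) : DerivesK45 T φ
  | hyp {T : Set (Formula V)} {φ : Formula V} (h : φ ∈ T) : DerivesK45 T φ
  | mp {T : Set (Formula V)} {φ ψ : Formula V}
      (h₁ : DerivesK45 T (imp φ ψ)) (h₂ : DerivesK45 T φ) : DerivesK45 T ψ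
  | nec {T : Set (Formula V)} {φ : Formula V} (h : DerivesK45 ∅ φ) : DerivesK45 T (box φ)

/-- The Goedel implication on `[0, 1]`: the residuum of the minimum. -/
noncomputable def gimp (a b : I) : I := if a ≤ b then 1 else b

/-- A possibilistic Goedel Kripke model: a non-empty set of worlds with an arbitrary (not
necessarily normalised) possibility distribution, and a `[0, 1]`-evaluation of the variables
in each world. -/
structure PiModel (V : Type u) : Type (max u (w + 1)) where
  /-- The set of worlds. -/
  World : Type w
  nonempty : Nonempty World
  /-- The possibility distribution. -/
  poss : World → I
  /-- The value of a variable at a world. -/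
  val : World → V → I

/-- The value `e(x, φ)` of a formula at a world of a possibilistic model; infima and suprema
are those of the complete lattice `[0, 1]`. -/
noncomputable def PiModel.eval {V : Type u} (M : PiModel.{u, w} V) :
    M.World → Formula V → I
  | x, .var q => M.val x q
  | _, .bot => 0
  | x, .and φ ψ => min (M.eval x φ) (M.eval x ψ)
  | x, .imp φ ψ => gimp (M.eval x φ) (M.eval x ψ)
  | _, .box φ => ⨅ y : M.World, gimp (M.poss y) (M.eval y φ)
  | _, .dia φ => ⨆ y : M.World, min (M.poss y) (M.eval y φ)

/-- Semantic consequence over the class of all possibilistic Goedel Kripke models: at every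
world of every model where all formulas of `T` have value `1`, so has `φ`. -/
def PiEntails {V : Type u} (T : Set (Formula V)) (φ : Formula V) : Prop :=
  ∀ (M : PiModel.{u, w} V) (x : M.World), (∀ ψ ∈ T, M.eval x ψ = 1) → M.eval x φ = 1

end GodelModal

namespace GodelModal

open Formula

variable {V : Type u}

/-! Goedel implication on the unit interval -/

theorem one_le_iff_eq_one {a : I} : 1 ≤ a ↔ a = 1 :=
  unitInterval.le_one'.ge_iff_eq

theorem le_gimp_iff {a b c : I} : c ≤ gimp a b ↔ min c a ≤ b := by
  unfold gimp
  split_ifs with h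
  · exact ⟨fun _ => (min_le_right _ _).trans h, fun _ => le_top⟩
  · refine ⟨fun hc => (min_le_left _ _).trans hc, fun hc => ?_⟩
    rcases min_le_iff.1 hc with h' | h'
    · exact h'
    · exact absurd h' h

theorem gimp_eq_one_iff {a b : I} : gimp a b = 1 ↔ a ≤ b := by
  rw [← one_le_iff_eq_one, le_gimp_iff, min_eq_right unitInterval.le_one']

theorem gimp_of_lt {a b : I} (h : b < a) : gimp a b = b := if_neg h.not_ge

theorem min_gimp_le (a b : I) : min (gimp a b) a ≤ b := le_gimp_iff.1 le_rfl

theorem le_gimp_of_le {a b c : I} (h : c ≤ b) : c ≤ gimp a b :=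
  le_gimp_iff.2 ((min_le_left _ _).trans h)

theorem gimp_lt_one_iff {a b : I} : gimp a b < 1 ↔ b < a := by
  rw [lt_iff_le_and_ne, Ne, gimp_eq_one_iff, not_le]
  exact and_iff_right le_top

/-- `max` is the Goedel disjunction. -/
theorem min_gimp_gimp_eq_max (a b : I) :
    min (gimp (gimp a b) b) (gimp (gimp b a) a) = max a b := by
  rcases lt_trichotomy a b with h | rfl | h
  · rw [gimp_eq_one_iff.2 h.le, gimp_of_lt h, gimp_eq_one_iff.2 le_rfl, max_eq_right h.le]
    rcases eq_or_ne b 1 with rfl | hb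
    · simp [gimp]
    · rw [gimp_of_lt (lt_of_le_of_ne unitInterval.le_one' hb)]; exact min_eq_left unitInterval.le_one'
  · simp only [gimp_eq_one_iff.2 le_rfl, min_self, max_self]
    rcases eq_or_ne a 1 with rfl | ha
    · simp [gimp]
    · rw [gimp_of_lt (lt_of_le_of_ne unitInterval.le_one' ha)]
  · rw [gimp_eq_one_iff.2 h.le, gimp_of_lt h, gimp_eq_one_iff.2 le_rfl, max_eq_left h.le]
    rcases eq_or_ne a 1 with rfl | hb
    · simp [gimp]
    · rw [gimp_of_lt (lt_of_le_of_ne unitInterval.le_one' hb)]; exact min_eq_right unitInterval.le_one'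

/-- Evaluations of the propositional connectives, where variables and modal formulas are
treated as atoms. -/
structure IsGodelHom (h : Formula V → I) : Prop where
  bot : h bot = 0
  and (φ ψ : Formula V) : h (and φ ψ) = min (h φ) (h ψ)
  imp (φ ψ : Formula V) : h (imp φ ψ) = gimp (h φ) (h ψ)

theorem IsGodelHom.imp_eq_one_iff {h : Formula V → I} (hh : IsGodelHom h) {φ ψ : Formula V} :
    h (Formula.imp φ ψ) = 1 ↔ h φ ≤ h ψ := by
  rw [hh.imp, gimp_eq_one_iff]

theorem IsGodelHom.top {h : Formula V → I} (hh : IsGodelHom h) : h Formula.top = 1 :=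
  hh.imp_eq_one_iff.2 le_rfl

theorem IsGodelHom.or {h : Formula V → I} (hh : IsGodelHom h) (φ ψ : Formula V) :
    h (Formula.or φ ψ) = max (h φ) (h ψ) := by
  simp only [Formula.or, hh.and, hh.imp, min_gimp_gimp_eq_max]

theorem PiModel.eval_isGodelHom (M : PiModel.{u, w} V) (x : M.World) : IsGodelHom (M.eval x) :=
  ⟨by simp [eval], fun _ _ => by simp [eval], fun _ _ => by simp [eval]⟩

/-! Soundness -/

theorem PiModel.eval_box_le (M : PiModel.{u, w} V) (x y : M.World) (φ : Formula V) :
    min (M.eval x (box φ)) (M.poss y) ≤ M.eval y φ := by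
  rw [eval, ← le_gimp_iff]
  exact iInf_le _ y

theorem PiModel.le_eval_box (M : PiModel.{u, w} V) (x : M.World) (φ : Formula V) (c : I)
    (h : ∀ y, min c (M.poss y) ≤ M.eval y φ) : c ≤ M.eval x (box φ) := by
  rw [eval]
  exact le_iInf fun y => le_gimp_iff.2 (h y)

theorem PiModel.le_eval_dia (M : PiModel.{u, w} V) (x y : M.World) (φ : Formula V) :
    min (M.poss y) (M.eval y φ) ≤ M.eval x (dia φ) := by
  rw [eval]
  exact le_iSup (fun y => min (M.poss y) (M.eval y φ)) y

theorem PiModel.eval_dia_le (M : PiModel.{u, w} V) (x : M.World) (φ : Formula V) (c : I)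
    (h : ∀ y, min (M.poss y) (M.eval y φ) ≤ c) : M.eval x (dia φ) ≤ c := by
  rw [eval]
  exact iSup_le h

theorem PiModel.eval_axiomK45 (M : PiModel.{u, w} V) (x : M.World) {φ : Formula V}
    (h : AxiomK45 φ) : M.eval x φ = 1 := by
  have hom := M.eval_isGodelHom
  have himp (y : M.World) (φ ψ : Formula V) :
      min (M.eval y (imp φ ψ)) (M.eval y φ) ≤ M.eval y ψ := by
    rw [(hom y).imp]; exact min_gimp_le _ _
  have boxc (y z : M.World) (φ : Formula V) : M.eval y (box φ) = M.eval z (box φ) := by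
    rw [eval, eval]
  have diac (y z : M.World) (φ : Formula V) : M.eval y (dia φ) = M.eval z (dia φ) := by
    rw [eval, eval]
  cases h with
  | a1 φ ψ χ =>
    rw [(hom x).imp_eq_one_iff, (hom x).imp (imp ψ χ), le_gimp_iff, (hom x).imp φ χ, le_gimp_iff]
    have h1 := himp x φ ψ
    have h2 := himp x ψ χ
    order
  | a2 φ ψ => rw [(hom x).imp_eq_one_iff, (hom x).and]; exact min_le_left _ _
  | a3 φ ψ => rw [(hom x).imp_eq_one_iff, (hom x).and, (hom x).and, min_comm]
  | a4a φ ψ χ =>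
    rw [(hom x).imp_eq_one_iff, (hom x).imp (and φ ψ), le_gimp_iff, (hom x).and]
    have h1 := himp x φ (imp ψ χ)
    have h2 := himp x ψ χ
    order
  | a4b φ ψ χ =>
    rw [(hom x).imp_eq_one_iff, (hom x).imp φ, le_gimp_iff, (hom x).imp ψ, le_gimp_iff]
    have h1 := himp x (and φ ψ) χ
    rw [(hom x).and] at h1
    order
  | a6 φ => rw [(hom x).imp_eq_one_iff, (hom x).and, min_self]
  | a7 φ ψ χ =>
    rw [(hom x).imp_eq_one_iff, (hom x).imp (imp (imp ψ φ) χ), le_gimp_iff]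
    have h1 := himp x (imp φ ψ) χ
    have h2 := himp x (imp ψ φ) χ
    rcases le_total (M.eval x φ) (M.eval x ψ) with h | h
    · rw [(hom x).imp_eq_one_iff.2 h, min_eq_left unitInterval.le_one'] at h1
      order
    · rw [(hom x).imp_eq_one_iff.2 h, min_eq_left unitInterval.le_one'] at h2
      order
  | a8 φ => rw [(hom x).imp_eq_one_iff, (hom x).bot]; exact bot_le
  | kBox φ ψ =>
    rw [(hom x).imp_eq_one_iff, (hom x).imp (box φ), le_gimp_iff]
    refine M.le_eval_box _ _ _ fun y => ?_
    have h1 := M.eval_box_le x y (imp φ ψ)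
    have h2 := M.eval_box_le x y φ
    have h3 := himp y φ ψ
    order
  | kDia φ ψ =>
    rw [(hom x).imp_eq_one_iff, (hom x).or]
    refine M.eval_dia_le _ _ _ fun y => ?_
    rw [(hom y).or]
    have h1 := M.le_eval_dia x y φ
    have h2 := M.le_eval_dia x y ψ
    order
  | fBox =>
    refine top_le_iff.1 (M.le_eval_box _ _ _ fun y => ?_)
    rw [(hom y).top]; exact le_top
  | fDia =>
    refine (hom x).imp_eq_one_iff.2 (M.eval_dia_le _ _ _ fun y => ?_)
    rw [(hom y).bot, (hom x).bot]; exact min_le_right _ _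
  | p φ ψ =>
    rw [(hom x).imp_eq_one_iff, (hom x).imp (dia φ), le_gimp_iff, min_comm, ← le_gimp_iff]
    refine M.eval_dia_le _ _ _ fun y => le_gimp_iff.2 ?_
    have h1 := M.eval_box_le x y (imp φ ψ)
    have h2 := himp y φ ψ
    have h3 := M.le_eval_dia x y ψ
    order
  | fs2 φ ψ =>
    rw [(hom x).imp_eq_one_iff]
    refine M.le_eval_box _ _ _ fun y => ?_
    rw [(hom y).imp, le_gimp_iff]
    have h1 := himp x (dia φ) (box ψ)
    have h2 := M.le_eval_dia x y φ
    have h3 := M.eval_box_le x y ψ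
    order
  | fourBox φ =>
    rw [(hom x).imp_eq_one_iff]
    refine M.le_eval_box _ _ _ fun y => ?_
    rw [boxc x y]; exact min_le_left _ _
  | fourDia φ =>
    rw [(hom x).imp_eq_one_iff]
    refine M.eval_dia_le _ _ _ fun y => ?_
    rw [diac x y]; exact min_le_right _ _
  | fiveBox φ =>
    rw [(hom x).imp_eq_one_iff]
    refine M.eval_dia_le _ _ _ fun y => ?_
    rw [boxc x y]; exact min_le_right _ _
  | fiveDia φ =>
    rw [(hom x).imp_eq_one_iff]
    refine M.le_eval_box _ _ _ fun y => ?_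
    rw [diac x y]; exact min_le_left _ _

theorem DerivesK45.sound {T : Set (Formula V)} {φ : Formula V} (h : DerivesK45 T φ) :
    PiEntails.{u, w} T φ := by
  intro M
  induction h with
  | ax h => exact fun x _ => M.eval_axiomK45 x h
  | hyp h => exact fun x hx => hx _ h
  | mp _ _ ih₁ ih₂ =>
    intro x hx
    have h := (M.eval_isGodelHom x).imp_eq_one_iff.1 (ih₁ x hx)
    rw [ih₂ x hx] at h
    exact top_le_iff.1 h
  | nec _ ih =>
    intro x _
    refine top_le_iff.1 (M.le_eval_box _ _ _ fun y => ?_)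
    rw [ih y (by simp)]
    exact le_top

/-! Derivations -/

namespace DerivesK45

variable {T : Set (Formula V)} {φ ψ χ : Formula V}

theorem mono {S : Set (Formula V)} (hST : S ⊆ T) (h : DerivesK45 S φ) : DerivesK45 T φ := by
  induction h generalizing T with
  | ax h => exact ax h
  | hyp h => exact hyp (hST h)
  | mp _ _ ih₁ ih₂ => exact mp (ih₁ hST) (ih₂ hST)
  | nec h _ => exact nec h

theorem exists_finite (h : DerivesK45 T φ) :
    ∃ S ⊆ T, S.Finite ∧ DerivesK45 S φ := by
  induction h with
  | ax h => exact ⟨∅, by simp, by simp, ax h⟩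
  | @hyp _ φ h => exact ⟨{φ}, by simpa, by simp, hyp rfl⟩
  | mp _ _ ih₁ ih₂ =>
    obtain ⟨S, hS, hS', h⟩ := ih₁
    obtain ⟨R, hR, hR', h'⟩ := ih₂
    exact ⟨S ∪ R, Set.union_subset hS hR, hS'.union hR',
      mp (h.mono Set.subset_union_left) (h'.mono Set.subset_union_right)⟩
  | nec h _ => exact ⟨∅, by simp, by simp, nec h⟩

theorem trans (h₁ : DerivesK45 T (imp φ ψ)) (h₂ : DerivesK45 T (imp ψ χ)) :
    DerivesK45 T (imp φ χ) :=
  mp (mp (ax (.a1 _ _ _)) h₁) h₂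

theorem imp_intro (φ : Formula V) (h : DerivesK45 T ψ) : DerivesK45 T (imp φ ψ) :=
  mp (mp (ax (.a4b _ _ _)) (ax (.a2 _ _))) h

theorem imp_self (φ : Formula V) : DerivesK45 T (imp φ φ) :=
  trans (ax (.a6 _)) (ax (.a2 _ _))

theorem imp_and (h : DerivesK45 T (imp φ ψ)) : DerivesK45 T (imp φ (and ψ φ)) :=
  trans (ax (.a6 _)) (mp (ax (.a4a _ _ _)) (trans h (mp (ax (.a4b _ _ _)) (imp_self _))))

theorem imp_mp (h₁ : DerivesK45 T (imp φ (imp ψ χ))) (h₂ : DerivesK45 T (imp φ ψ)) :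
    DerivesK45 T (imp φ χ) :=
  trans (trans (imp_and h₂) (ax (.a3 _ _))) (mp (ax (.a4a _ _ _)) h₁)

/-- The deduction theorem. -/
theorem deduction (h : DerivesK45 (insert φ T) ψ) : DerivesK45 T (imp φ ψ) := by
  generalize hS : insert φ T = S at h
  induction h with
  | ax h => exact imp_intro _ (ax h)
  | hyp h =>
    subst hS
    rcases h with rfl | h
    · exact imp_self _
    · exact imp_intro _ (hyp h)
  | mp _ _ ih₁ ih₂ => exact imp_mp (ih₁ hS) (ih₂ hS)
  | nec h _ => exact imp_intro _ (nec h)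

end DerivesK45

/-! Completeness of the propositional part -/

theorem exists_maximal_theory {T : Set (Formula V)} {φ : Formula V} (h : ¬ DerivesK45 T φ) :
    ∃ P, T ⊆ P ∧ Maximal (fun S => ¬ DerivesK45 S φ) P := by
  refine zorn_subset_nonempty {S | ¬ DerivesK45 S φ} (fun c hc hchain hne => ?_) T h
  refine ⟨⋃₀ c, fun hd => ?_, fun s hs => Set.subset_sUnion_of_mem hs⟩
  obtain ⟨S, hS, hfin, hd'⟩ := hd.exists_finite
  obtain ⟨R, hR, hSR⟩ :=
    DirectedOn.exists_mem_subset_of_finite_of_subset_sUnion hne hchain.directedOn hfin hS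
  exact hc hR (hd'.mono hSR)

theorem derives_imp_total {P : Set (Formula V)} {φ : Formula V}
    (hP : Maximal (fun S => ¬ DerivesK45 S φ) P) (ψ χ : Formula V) :
    DerivesK45 P (imp ψ χ) ∨ DerivesK45 P (imp χ ψ) := by
  have key (θ : Formula V) (hθ : ¬ DerivesK45 P θ) : DerivesK45 P (imp θ φ) := by
    refine DerivesK45.deduction (by_contra fun hn => hθ (.hyp ?_))
    exact hP.2 hn (Set.subset_insert _ _) (Set.mem_insert _ _)
  by_contra! hc
  exact hP.1 (.mp (.mp (.ax (.a7 _ _ _)) (key _ hc.1)) (key _ hc.2))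

instance [Countable V] : Countable (Formula V) := by
  obtain ⟨e, he⟩ := exists_injective_nat V
  let f : Formula V → ℕ := fun φ => Formula.rec (fun p => Nat.pair 0 (e p)) (Nat.pair 1 0)
    (fun _ _ a b => Nat.pair 2 (Nat.pair a b)) (fun _ _ a b => Nat.pair 3 (Nat.pair a b))
    (fun _ a => Nat.pair 4 a) (fun _ a => Nat.pair 5 a) φ
  refine Function.Injective.countable (f := f) fun φ => ?_
  induction φ with
  | var p => intro ψ h; cases ψ <;> simp_all [f, Nat.pair_eq_pair, he.eq_iff]
  | bot => intro ψ h; cases ψ <;> simp_all [f, Nat.pair_eq_pair]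
  | and a b iha ihb =>
    intro ψ h
    cases ψ <;> simp only [f, Nat.pair_eq_pair] at h <;> simp at h
    rw [iha h.1, ihb h.2]
  | imp a b iha ihb =>
    intro ψ h
    cases ψ <;> simp only [f, Nat.pair_eq_pair] at h <;> simp at h
    rw [iha h.1, ihb h.2]
  | box a iha =>
    intro ψ h
    cases ψ <;> simp only [f, Nat.pair_eq_pair] at h <;> simp at h
    rw [iha h]
  | dia a iha =>
    intro ψ h
    cases ψ <;> simp only [f, Nat.pair_eq_pair] at h <;> simp at h
    rw [iha h]

/-- A countable total preorder with distinct least and greatest elements embeds in `[0, 1]`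
with the ends going to the ends. -/
theorem exists_unitInterval_embedding {α : Type*} [Countable α] (r : α → α → Prop)
    (hrefl : ∀ a, r a a) (htrans : ∀ a b c, r a b → r b c → r a c) (htot : ∀ a b, r a b ∨ r b a)
    (x y : α) (hx : ∀ a, r x a) (hy : ∀ a, r a y) (hxy : ¬ r y x) :
    ∃ f : α → I, (∀ a b, f a ≤ f b ↔ r a b) ∧ f x = 0 ∧ f y = 1 := by
  classical
  let _ : Preorder α := { le := r, le_refl := hrefl, le_trans := htrans }
  have : Std.Total (α := α) (· ≤ ·) := ⟨htot⟩
  have : Countable (Antisymmetrization α (· ≤ ·)) :=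
    inferInstanceAs (Countable (Quotient (AntisymmRel.setoid α (· ≤ ·))))
  obtain ⟨e⟩ := Order.embedding_from_countable_to_dense (Antisymmetrization α (· ≤ ·)) ℝ
  let k : α → ℝ := fun a => e (toAntisymmetrization (· ≤ ·) a)
  have hk (a b : α) : k a ≤ k b ↔ r a b := by
    simp only [k, e.le_iff_le, toAntisymmetrization_le_toAntisymmetrization_iff]
    rfl
  have hpos : 0 < k y - k x := by
    rw [sub_pos, ← not_le, hk]; exact hxy
  refine ⟨fun a => ⟨(k a - k x) / (k y - k x), ?_, ?_⟩, fun a b => ?_, ?_, ?_⟩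
  · exact div_nonneg (sub_nonneg.2 ((hk _ _).2 (hx a))) hpos.le
  · rw [div_le_one hpos]
    linarith [(hk _ _).2 (hy a)]
  · change (k a - k x) / (k y - k x) ≤ (k b - k x) / (k y - k x) ↔ _
    rw [div_le_div_iff_of_pos_right hpos, sub_le_sub_iff_right, hk]
  · ext; simp
  · ext; simp [hpos.ne']

/-- Strong completeness of Goedel logic over the theorems of `K45(G)`. -/
theorem exists_godelHom_of_not_derives [Countable V] {T : Set (Formula V)} {φ : Formula V}
    (h : ¬ DerivesK45 T φ) :
    ∃ u : Formula V → I, IsGodelHom u ∧ (∀ χ, DerivesK45 T χ → u χ = 1) ∧ u φ < 1 := by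
  obtain ⟨P, hTP, hP⟩ := exists_maximal_theory h
  have hP' : ¬ DerivesK45 P φ := hP.1
  have htop : DerivesK45 P Formula.top := .imp_self _
  obtain ⟨u, hu, hu0, hu1⟩ := exists_unitInterval_embedding
    (fun ψ χ : Formula V => DerivesK45 P (imp ψ χ)) (fun _ => .imp_self _)
    (fun _ _ _ => .trans) (derives_imp_total hP) bot Formula.top (fun _ => .ax (.a8 _))
    (fun _ => .imp_intro _ htop) (fun h' => hP' (.mp (.ax (.a8 _)) (.mp h' htop)))
  have hone (χ : Formula V) : u χ = 1 ↔ DerivesK45 P χ := by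
    rw [← one_le_iff_eq_one, ← hu1, hu]
    exact ⟨fun h' => .mp h' htop, fun h' => .imp_intro _ h'⟩
  refine ⟨u, ⟨hu0, fun ψ χ => ?_, fun ψ χ => ?_⟩, fun χ hχ => (hone χ).2 (hχ.mono hTP), ?_⟩
  · apply le_antisymm
    · exact le_min ((hu _ _).2 (.ax (.a2 _ _)))
        ((hu _ _).2 (.trans (.ax (.a3 _ _)) (.ax (.a2 _ _))))
    · rcases le_total (u ψ) (u χ) with hle | hle
      · rw [min_eq_left hle, hu]
        exact .trans (.imp_and ((hu _ _).1 hle)) (.ax (.a3 _ _))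
      · rw [min_eq_right hle, hu]
        exact .imp_and ((hu _ _).1 hle)
  · by_cases hle : u ψ ≤ u χ
    · rw [gimp_eq_one_iff.2 hle, hone]
      exact (hu _ _).1 hle
    · rw [gimp_of_lt (not_le.1 hle)]
      refine le_antisymm ((hu _ _).2 ?_) ((hu _ _).2 (.deduction (.imp_intro _ (.hyp (by simp)))))
      rcases derives_imp_total hP ψ (imp ψ χ) with h' | h'
      · exact absurd ((hu _ _).2 (.imp_mp h' (.imp_self _))) hle
      · exact .imp_mp (.imp_self _) h'
  · exact lt_of_le_of_ne le_top fun h' => hP' ((hone _).1 h')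

/-! Extending strictly monotone maps from finite sets -/

theorem exists_strictMono_eqOn_real (S : Finset ℝ) (f : ℝ → ℝ) (hf : StrictMonoOn f S) :
    ∃ g : ℝ → ℝ, StrictMono g ∧ Set.EqOn g f S := by
  induction S using Finset.induction_on_max with
  | empty => exact ⟨id, strictMono_id, by simp⟩
  | insert a S ha ih =>
    obtain ⟨g, hg, hgf⟩ := ih (hf.mono (by simp))
    rcases S.eq_empty_or_nonempty with rfl | hne
    · exact ⟨fun x => x + (f a - a), fun x y h => by simpa using h, by simp⟩
    · obtain ⟨m, hm, hmax⟩ := S.exists_max_image id hne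
      have hma : m < a := ha m hm
      have hfm : f m < f a := hf (by simp [hm]) (by simp) hma
      have hk : 0 < (f a - f m) / (a - m) := div_pos (by linarith) (by linarith)
      have hgm : g m = f m := hgf hm
      refine ⟨fun x => if x ≤ m then g x else f m + (x - m) * ((f a - f m) / (a - m)),
        fun x y hxy => ?_, fun x hx => ?_⟩
      · dsimp only
        split_ifs with h1 h2 h2
        · exact hg hxy
        · have : g x ≤ g m := hg.monotone h1
          have := mul_pos (sub_pos.2 (not_le.1 h2)) hk
          linarith
        · linarith
        · gcongr
      · rcases Finset.mem_insert.1 hx with rfl | hx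
        · simp only [not_le.2 hma, if_false]
          field_simp [sub_ne_zero.2 hma.ne']
          ring
        · simp only [show x ≤ m from hmax x hx, if_true]
          exact hgf hx

theorem exists_strictMono_eqOn (S : Finset I) (f : I → I) (hf : StrictMonoOn f S)
    (h0 : 0 ∈ S) (h1 : 1 ∈ S) : ∃ g : I → I, StrictMono g ∧ Set.EqOn g f S := by
  let F : ℝ → ℝ := fun x => f (Set.projIcc 0 1 zero_le_one x)
  have hF (x : I) : F x = f x := by simp [F]
  obtain ⟨g, hg, hgF⟩ := exists_strictMono_eqOn_real (S.image (↑)) F (by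
    intro x hx y hy hxy
    simp only [Finset.coe_image, Set.mem_image, Finset.mem_coe] at hx hy
    obtain ⟨x, hx, rfl⟩ := hx
    obtain ⟨y, hy, rfl⟩ := hy
    rw [hF, hF]
    exact hf hx hy hxy)
  have hgf (x : I) (hx : x ∈ S) : g x = f x := by
    rw [← hF]; exact hgF (by simpa using ⟨x.2, hx⟩)
  refine ⟨fun x => ⟨g x, ?_, ?_⟩, fun x y h => hg h, fun x hx => Subtype.ext (hgf x hx)⟩
  · exact ((f 0).2.1.trans_eq (hgf 0 h0).symm).trans (hg.monotone x.2.1)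
  · exact (hg.monotone x.2.2).trans ((hgf 1 h1).trans_le (f 1).2.2)

theorem exists_between_finite {S : Finset I} {f : I → I} {t lo hi : I}
    (hf : ∀ s ∈ S, ∀ s' ∈ S, s < t → t < s' → f s < f s') (hlh : lo < hi)
    (hhi : ∀ s ∈ S, s < t → f s < hi) (hlo : ∀ s ∈ S, t < s → lo < f s) :
    ∃ y, lo < y ∧ y < hi ∧ (∀ s ∈ S, s < t → f s < y) ∧ ∀ s ∈ S, t < s → y < f s := by
  classical
  let A := insert lo ((S.filter (· < t)).image f)
  let B := insert hi ((S.filter (t < ·)).image f)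
  have hA : A.Nonempty := by simp [A]
  have hB : B.Nonempty := by simp [B]
  have hAB : A.max' hA < B.min' hB := by
    rw [Finset.max'_lt_iff]
    intro a ha
    rw [Finset.lt_min'_iff]
    intro b hb
    simp only [A, B, Finset.mem_insert, Finset.mem_image, Finset.mem_filter] at ha hb
    rcases ha with rfl | ⟨s, ⟨hs, hst⟩, rfl⟩ <;> rcases hb with rfl | ⟨s', ⟨hs', hst'⟩, rfl⟩
    · exact hlh
    · exact hlo _ hs' hst'
    · exact hhi _ hs hst
    · exact hf _ hs _ hs' hst hst'
  obtain ⟨y, hy1, hy2⟩ := exists_between hAB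
  rw [Finset.max'_lt_iff] at hy1
  rw [Finset.lt_min'_iff] at hy2
  refine ⟨y, hy1 _ (by simp [A]), hy2 _ (by simp [B]), fun s hs hst => hy1 _ ?_,
    fun s hs hst => hy2 _ ?_⟩
  · exact Finset.mem_insert_of_mem (Finset.mem_image_of_mem _ (by simp [hs, hst]))
  · exact Finset.mem_insert_of_mem (Finset.mem_image_of_mem _ (by simp [hs, hst]))

/-- A strictly monotone map on a finite set extends to `[0, 1]` with a prescribed approximate
value at one further point. -/
theorem exists_strictMono_eqOn_between {S : Finset I} {f : I → I} (hf : StrictMonoOn f S)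
    (h0 : 0 ∈ S) (h1 : 1 ∈ S) {t lo hi : I} (hlh : lo < hi)
    (hhi : ∀ s ∈ S, s < t → f s < hi) (hlo : ∀ s ∈ S, t < s → lo < f s) :
    ∃ g : I → I, StrictMono g ∧ Set.EqOn g f S ∧ (t ∉ S → lo < g t ∧ g t < hi) := by
  classical
  by_cases ht : t ∈ S
  · obtain ⟨g, hg, hgf⟩ := exists_strictMono_eqOn S f hf h0 h1
    exact ⟨g, hg, hgf, fun h => absurd ht h⟩
  obtain ⟨y, hy1, hy2, hy3, hy4⟩ := exists_between_finite
    (fun s hs s' hs' h h' => hf hs hs' (h.trans h')) hlh hhi hlo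
  have hne {s : I} (hs : s ∈ S) : s ≠ t := fun h => ht (h ▸ hs)
  obtain ⟨g, hg, hgf⟩ := exists_strictMono_eqOn (insert t S) (Function.update f t y) (by
    intro a ha b hb hab
    rcases Finset.mem_insert.1 ha with rfl | ha <;> rcases Finset.mem_insert.1 hb with rfl | hb
    · exact absurd hab (lt_irrefl _)
    · simpa [hne hb] using hy4 b hb hab
    · simpa [hne ‹a ∈ S›] using hy3 a ‹a ∈ S› hab
    · simpa [hne ‹a ∈ S›, hne hb] using hf ‹a ∈ S› hb hab) (by simp [h0]) (by simp [h1])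
  refine ⟨g, hg, fun s hs => ?_, fun _ => ?_⟩
  · rw [hgf (by simp [Finset.mem_coe.1 hs]), Function.update_of_ne (hne hs)]
  · rw [hgf (by simp), Function.update_self]
    exact ⟨hy1, hy2⟩

/-- If `u` preserves the order of the values of `v` on a finite set, up to identifying an upper
segment with `1`, then `v` is recovered from `u` below `1` by a strictly monotone map. -/
theorem exists_strictMonoOn_recover {α : Type*} [DecidableEq α] {M : Finset α} {u v : α → I}
    {x y : α} (hx : x ∈ M) (hy : y ∈ M) (hux : u x = 0) (hvx : v x = 0) (huy : u y = 1)
    (hle : ∀ a ∈ M, ∀ b ∈ M, v a ≤ v b → u a ≤ u b)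
    (hlt : ∀ a ∈ M, ∀ b ∈ M, v a < v b → u a < u b ∨ u a = 1) :
    ∃ f : I → I, StrictMonoOn f (M.image u) ∧ f 0 = 0 ∧ (∀ a ∈ M, u a < 1 → f (u a) = v a) ∧
      (∀ a ∈ M, u a = 1 → f 1 ≤ v a) ∧ ∃ a ∈ M, u a = 1 ∧ f 1 = v a := by
  let f : I → I := fun s => (M.filter (s ≤ u ·)).inf v
  have hfle (a : α) (ha : a ∈ M) (s : I) (hs : s ≤ u a) : f s ≤ v a :=
    Finset.inf_le (by simp [ha, hs])
  have hmem (s : I) : ∃ a ∈ M, s ≤ u a ∧ f s = v a := by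
    obtain ⟨a, ha, h⟩ := Finset.exists_mem_eq_inf (M.filter (s ≤ u ·))
      ⟨y, by simp [hy, huy, unitInterval.le_one']⟩ v
    rw [Finset.mem_filter] at ha
    exact ⟨a, ha.1, ha.2, h⟩
  have hval (a : α) (ha : a ∈ M) (h1 : u a < 1) : f (u a) = v a := by
    obtain ⟨b, hb, hab, hfb⟩ := hmem (u a)
    refine le_antisymm (hfle a ha _ le_rfl) (hfb ▸ not_lt.1 fun h => ?_)
    rcases hlt b hb a ha h with h' | h'
    · exact absurd hab h'.not_ge
    · exact absurd (h' ▸ hle b hb a ha h.le) h1.not_ge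
  refine ⟨f, fun s hs s' hs' hss => ?_, ?_, hval, fun a ha h => hfle a ha _ h.ge, ?_⟩
  · simp only [Finset.coe_image, Set.mem_image, Finset.mem_coe] at hs hs'
    obtain ⟨a, ha, rfl⟩ := hs
    rw [hval a ha (hss.trans_le unitInterval.le_one')]
    obtain ⟨b, hb, hsb, hfb⟩ := hmem s'
    rw [hfb]
    exact not_le.1 fun h => absurd (hle b hb a ha h) (hss.trans_le hsb).not_ge
  · exact le_antisymm (hvx ▸ hfle x hx 0 (hux ▸ le_rfl)) unitInterval.nonneg'
  · obtain ⟨a, ha, h1, h2⟩ := hmem 1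
    exact ⟨a, ha, one_le_iff_eq_one.1 h1, h2⟩

/-! Rescaling propositional evaluations -/

/-- The propositional evaluation with given values of variables and modal formulas. -/
noncomputable def godelExtend (a : Formula V → I) : Formula V → I
  | .var p => a (.var p)
  | .bot => 0
  | .and φ ψ => min (godelExtend a φ) (godelExtend a ψ)
  | .imp φ ψ => gimp (godelExtend a φ) (godelExtend a ψ)
  | .box φ => a (.box φ)
  | .dia φ => a (.dia φ)

theorem godelExtend_isGodelHom (a : Formula V → I) : IsGodelHom (godelExtend a) :=
  ⟨rfl, fun _ _ => rfl, fun _ _ => rfl⟩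

/-- The formulas whose main connective is a modality. -/
def IsModalized (φ : Formula V) : Prop := ∃ ψ, φ = box ψ ∨ φ = dia ψ

/-- An evaluation can be rescaled by a strictly monotone map, with the values at `1` spread out
over an upper segment. -/
theorem IsGodelHom.exists_rescaled {u v : Formula V → I} (hu : IsGodelHom u)
    {M : Set (Formula V)} {g : I → I} (hg : StrictMono g) (hg0 : g 0 = 0)
    (hM : ∀ X ∈ M, u X < 1 → g (u X) = v X) (hM1 : ∀ X ∈ M, u X = 1 → g 1 ≤ v X) :
    ∃ h : Formula V → I, IsGodelHom h ∧ (∀ X ∈ M, IsModalized X → h X = v X) ∧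
      (∀ ψ, u ψ < 1 → h ψ = g (u ψ)) ∧ ∀ ψ, u ψ = 1 → g 1 ≤ h ψ := by
  classical
  let a : Formula V → I := fun X => if X ∈ M then v X else if u X = 1 then 1 else g (u X)
  have ha (X : Formula V) : (u X < 1 → a X = g (u X)) ∧ (u X = 1 → g 1 ≤ a X) := by
    by_cases hX : X ∈ M
    · simp only [a, hX, if_true]
      exact ⟨fun h => (hM X hX h).symm, hM1 X hX⟩
    · simp only [a, hX, if_false]
      refine ⟨fun h => if_neg h.ne, fun h => ?_⟩
      rw [if_pos h]; exact unitInterval.le_one'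
  have key (ψ : Formula V) : (u ψ < 1 → godelExtend a ψ = g (u ψ)) ∧
      (u ψ = 1 → g 1 ≤ godelExtend a ψ) := by
    have hlt1 (x : I) : x < 1 ∨ x = 1 := lt_or_eq_of_le unitInterval.le_one'
    induction ψ with
    | var p => exact ha _
    | box φ => exact ha _
    | dia φ => exact ha _
    | bot => rw [hu.bot]; exact ⟨fun _ => hg0.symm, fun h => absurd h zero_ne_one⟩
    | and φ ψ ihφ ihψ =>
      rw [hu.and, godelExtend]
      rcases hlt1 (u φ) with hφ | hφ <;> rcases hlt1 (u ψ) with hψ | hψ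
      · rw [ihφ.1 hφ, ihψ.1 hψ]
        exact ⟨fun _ => (hg.monotone.map_min).symm,
          fun h => absurd h (min_lt_of_left_lt hφ).ne⟩
      · rw [hψ, min_eq_left unitInterval.le_one', ihφ.1 hφ]
        exact ⟨fun _ => min_eq_left ((hg hφ).le.trans (ihψ.2 hψ)), fun h => absurd h hφ.ne⟩
      · rw [hφ, min_eq_right unitInterval.le_one', ihψ.1 hψ]
        exact ⟨fun _ => min_eq_right ((hg hψ).le.trans (ihφ.2 hφ)), fun h => absurd h hψ.ne⟩
      · rw [hφ, hψ, min_self]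
        exact ⟨fun h => absurd h (lt_irrefl _), fun _ => le_min (ihφ.2 hφ) (ihψ.2 hψ)⟩
    | imp φ ψ ihφ ihψ =>
      rw [hu.imp, godelExtend]
      rcases le_or_gt (u φ) (u ψ) with hle | hlt
      · rw [gimp_eq_one_iff.2 hle]
        refine ⟨fun h => absurd h (lt_irrefl _), fun _ => ?_⟩
        rcases hlt1 (u ψ) with hψ | hψ
        · have hφ := hle.trans_lt hψ
          rw [ihφ.1 hφ, ihψ.1 hψ, gimp_eq_one_iff.2 (hg.monotone hle)]
          exact unitInterval.le_one'
        · exact le_gimp_of_le (ihψ.2 hψ)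
      · have hψ : u ψ < 1 := hlt.trans_le unitInterval.le_one'
        rw [gimp_of_lt hlt, ihψ.1 hψ]
        refine ⟨fun _ => gimp_of_lt ?_, fun h => absurd h hψ.ne⟩
        rcases hlt1 (u φ) with hφ | hφ
        · rw [ihφ.1 hφ]; exact hg hlt
        · exact (hg hψ).trans_le (ihφ.2 hφ)
  refine ⟨godelExtend a, godelExtend_isGodelHom a, fun X hX hmod => ?_, fun ψ => (key ψ).1,
    fun ψ => (key ψ).2⟩
  obtain ⟨ψ, rfl | rfl⟩ := hmod <;> simp [godelExtend, a, hX]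

/-! Evaluations satisfying the theorems of the logic -/

/-- An evaluation under which all theorems of `K45(G)` have value `1`. -/
structure IsK45Hom (v : Formula V → I) : Prop extends IsGodelHom v where
  thm (χ : Formula V) : DerivesK45 ∅ χ → v χ = 1

namespace IsK45Hom

variable {v : Formula V → I} (hv : IsK45Hom v)
include hv

theorem le_of_axiomK45 {φ ψ : Formula V} (h : AxiomK45 (Formula.imp φ ψ)) : v φ ≤ v ψ :=
  hv.imp_eq_one_iff.1 (hv.thm _ (.ax h))

theorem box_le_box {φ ψ : Formula V} (h : v (box (Formula.imp φ ψ)) = 1) :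
    v (box φ) ≤ v (box ψ) := by
  have := hv.le_of_axiomK45 (.kBox φ ψ)
  rw [h, one_le_iff_eq_one] at this
  exact hv.imp_eq_one_iff.1 this

theorem dia_le_dia {φ ψ : Formula V} (h : v (box (Formula.imp φ ψ)) = 1) :
    v (dia φ) ≤ v (dia ψ) := by
  have := hv.le_of_axiomK45 (.p φ ψ)
  rw [h, one_le_iff_eq_one] at this
  exact hv.imp_eq_one_iff.1 this

theorem box_imp_eq_one {φ ψ : Formula V} (h : v (dia φ) ≤ v (box ψ)) :
    v (box (Formula.imp φ ψ)) = 1 := by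
  have := hv.le_of_axiomK45 (.fs2 φ ψ)
  rwa [hv.imp_eq_one_iff.2 h, one_le_iff_eq_one] at this

/-- The formulas that `v` makes necessary form a theory. -/
theorem box_eq_one_of_derives {φ : Formula V} (h : DerivesK45 {χ | v (box χ) = 1} φ) :
    v (box φ) = 1 := by
  generalize hT : {χ | v (box χ) = 1} = T at h
  induction h with
  | ax h => exact hv.thm _ (.nec (.ax h))
  | hyp h => subst hT; exact h
  | mp _ _ ih₁ ih₂ =>
    have := hv.box_le_box (ih₁ hT)
    rwa [ih₂ hT, one_le_iff_eq_one] at this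
  | nec h _ => exact hv.thm _ (.nec (.nec h))

theorem box_box_imp_self (φ : Formula V) : v (box (Formula.imp (box φ) φ)) = 1 :=
  hv.box_imp_eq_one (hv.le_of_axiomK45 (.fiveBox φ))

theorem box_imp_dia_self (φ : Formula V) : v (box (Formula.imp φ (dia φ))) = 1 :=
  hv.box_imp_eq_one (hv.le_of_axiomK45 (.fiveDia φ))

end IsK45Hom

/-- `v` treats `φ` as having the same value in all worlds. -/
structure IsRigid (v : Formula V → I) (φ : Formula V) : Prop where
  le_box : v φ ≤ v (box φ)
  dia_le : v (dia φ) ≤ v φ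

namespace IsK45Hom

variable {v : Formula V → I} (hv : IsK45Hom v)
include hv

theorem isRigid_bot : IsRigid v Formula.bot :=
  ⟨hv.bot ▸ unitInterval.nonneg', hv.le_of_axiomK45 .fDia⟩

theorem isRigid_top : IsRigid v Formula.top :=
  ⟨(hv.thm _ (.ax .fBox)).symm ▸ unitInterval.le_one', hv.top ▸ unitInterval.le_one'⟩

theorem isRigid_of_isModalized {φ : Formula V} (h : IsModalized φ) : IsRigid v φ := by
  obtain ⟨ψ, rfl | rfl⟩ := h
  · exact ⟨hv.le_of_axiomK45 (.fourBox ψ), hv.le_of_axiomK45 (.fiveBox ψ)⟩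
  · exact ⟨hv.le_of_axiomK45 (.fiveDia ψ), hv.le_of_axiomK45 (.fourDia ψ)⟩

theorem dia_imp_le {φ ψ : Formula V} (hφ : IsRigid v φ) (hψ : IsRigid v ψ) :
    v (dia (Formula.imp φ ψ)) ≤ v (Formula.imp φ ψ) := by
  rw [hv.imp, le_gimp_iff, min_comm, ← le_gimp_iff]
  have hd : DerivesK45 ∅ (Formula.imp φ (Formula.imp (Formula.imp φ ψ) ψ)) :=
    .deduction (.deduction (.mp (φ := φ) (.hyp (by simp)) (.hyp (by simp))))
  have h1 := hv.box_le_box (hv.thm _ (.nec hd))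
  have h2 := hv.le_of_axiomK45 (.p (Formula.imp φ ψ) ψ)
  rw [hv.imp, le_gimp_iff] at h2
  rw [le_gimp_iff]
  have h3 := hφ.le_box
  have h4 := hψ.dia_le
  order

variable {u : Formula V → I} (hu : IsGodelHom u) (huv : ∀ χ, v (box χ) = 1 → u χ = 1)
include hu huv

theorem le_of_le {φ ψ : Formula V} (hφ : IsRigid v φ) (hψ : IsRigid v ψ) (h : v φ ≤ v ψ) :
    u φ ≤ u ψ :=
  hu.imp_eq_one_iff.1 (huv _ (hv.box_imp_eq_one (hφ.dia_le.trans (h.trans hψ.le_box))))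

theorem lt_or_eq_one_of_lt {φ ψ : Formula V} (hφ : IsRigid v φ) (hψ : IsRigid v ψ)
    (h : v φ < v ψ) : u φ < u ψ ∨ u φ = 1 := by
  have h1 : v (dia (Formula.imp ψ φ)) ≤ v (box φ) := by
    refine (hv.dia_imp_le hψ hφ).trans ?_
    rw [hv.imp, gimp_of_lt h]
    exact hφ.le_box
  have h2 := hu.imp_eq_one_iff.1 (huv _ (hv.box_imp_eq_one h1))
  rcases lt_or_ge (u φ) (u ψ) with h' | h'
  · exact .inl h'
  · rw [hu.imp_eq_one_iff.2 h', one_le_iff_eq_one] at h2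
    exact .inr h2

end IsK45Hom

/-! The canonical model -/

/-- The modal formulas of a finite set, together with `⊥` and `⊤`. -/
noncomputable def rigidPart (S : Finset (Formula V)) : Finset (Formula V) :=
  open Classical in insert Formula.bot (insert Formula.top (S.filter IsModalized))

theorem mem_rigidPart {S : Finset (Formula V)} {X : Formula V} (h : X ∈ S)
    (hX : IsModalized X) : X ∈ rigidPart S := by
  simp [rigidPart, h, hX]

theorem bot_mem_rigidPart (S : Finset (Formula V)) : Formula.bot ∈ rigidPart S := by
  simp [rigidPart]

theorem top_mem_rigidPart (S : Finset (Formula V)) : Formula.top ∈ rigidPart S := by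
  simp [rigidPart]

theorem IsK45Hom.isRigid_of_mem {v : Formula V → I} (hv : IsK45Hom v) {S : Finset (Formula V)}
    {X : Formula V} (hX : X ∈ rigidPart S) : IsRigid v X := by
  simp only [rigidPart, Finset.mem_insert, Finset.mem_filter] at hX
  rcases hX with rfl | rfl | hX
  · exact hv.isRigid_bot
  · exact hv.isRigid_top
  · exact hv.isRigid_of_isModalized hX.2

/-- The worlds of the canonical model: evaluations that agree with `v` on the modal formulas
of `S`. -/
def CanonicalWorld (v : Formula V → I) (S : Finset (Formula V)) : Type u :=
  {h : Formula V → I // IsGodelHom h ∧ ∀ X ∈ S, IsModalized X → h X = v X}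

/-- The possibility of a world: the degree to which it satisfies what `v` makes necessary. -/
noncomputable def canonicalPoss (v h : Formula V → I) : I := ⨅ χ : {χ // v (box χ) = 1}, h χ

theorem canonicalPoss_le {v h : Formula V → I} {χ : Formula V} (hχ : v (box χ) = 1) :
    canonicalPoss v h ≤ h χ :=
  iInf_le (fun χ : {χ // v (box χ) = 1} => h χ) ⟨χ, hχ⟩

/-- Rescaling gives a world of the canonical model. -/
theorem IsGodelHom.exists_world [DecidableEq (Formula V)] {u v : Formula V → I}
    (hu : IsGodelHom u) (S : Finset (Formula V)) (huv : ∀ χ, v (box χ) = 1 → u χ = 1) {f g : I → I} (hf0 : f 0 = 0)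
    (hf : ∀ a ∈ rigidPart S, u a < 1 → f (u a) = v a)
    (hf1 : ∀ a ∈ rigidPart S, u a = 1 → f 1 ≤ v a)
    (hg : StrictMono g) (hgf : Set.EqOn g f ((rigidPart S).image u)) :
    ∃ h : CanonicalWorld v S, g 1 ≤ canonicalPoss v h.1 ∧
      (∀ ψ, u ψ < 1 → h.1 ψ = g (u ψ)) ∧ ∀ ψ, u ψ = 1 → g 1 ≤ h.1 ψ := by
  have hmem {a : Formula V} (ha : a ∈ rigidPart S) : g (u a) = f (u a) :=
    hgf (by simpa using ⟨a, ha, rfl⟩)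
  have hg0 : g 0 = 0 := by
    rw [← hu.bot, hmem (bot_mem_rigidPart S), hu.bot, hf0]
  have hg1 : g 1 = f 1 := by rw [← hu.top]; exact hmem (top_mem_rigidPart S)
  obtain ⟨h, hh, hhv, hlt, hone⟩ := hu.exists_rescaled (v := v) (M := ↑(rigidPart S)) hg hg0
    (fun X hX hX1 => (hmem hX).trans (hf X hX hX1)) (fun X hX hX1 => hg1.trans_le (hf1 X hX hX1))
  exact ⟨⟨h, hh, fun X hX hmod => hhv X (mem_rigidPart hX hmod) hmod⟩,
    le_iInf fun χ => hone _ (huv _ χ.2), hlt, hone⟩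

section

variable {v : Formula V → I} (hv : IsK45Hom v) (S : Finset (Formula V))
include hv

theorem IsK45Hom.exists_godelHom [Countable V] {φ : Formula V} (h : v (box φ) ≠ 1) :
    ∃ u, IsGodelHom u ∧ (∀ χ, v (box χ) = 1 → u χ = 1) ∧ u φ < 1 := by
  obtain ⟨u, hu, hu1, hφ⟩ :=
    exists_godelHom_of_not_derives (fun hd => h (hv.box_eq_one_of_derives hd))
  exact ⟨u, hu, fun χ hχ => hu1 χ (.hyp hχ), hφ⟩

/-- The values of modal formulas under `v` are recovered from those under `u`. -/
theorem IsK45Hom.exists_recover [DecidableEq (Formula V)] {u : Formula V → I}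
    (hu : IsGodelHom u) (huv : ∀ χ, v (box χ) = 1 → u χ = 1) :
    ∃ f : I → I, StrictMonoOn f ((rigidPart S).image u) ∧ f 0 = 0 ∧
      (∀ a ∈ rigidPart S, u a < 1 → f (u a) = v a) ∧
      (∀ a ∈ rigidPart S, u a = 1 → f 1 ≤ v a) ∧ ∃ a ∈ rigidPart S, u a = 1 ∧ f 1 = v a :=
  exists_strictMonoOn_recover (bot_mem_rigidPart S) (top_mem_rigidPart S) hu.bot hv.bot hu.top
    (fun _ ha _ hb => hv.le_of_le hu huv (hv.isRigid_of_mem ha) (hv.isRigid_of_mem hb))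
    (fun _ ha _ hb => hv.lt_or_eq_one_of_lt hu huv (hv.isRigid_of_mem ha) (hv.isRigid_of_mem hb))

theorem IsK45Hom.exists_world_box [Countable V] {φ : Formula V} (hφ : box φ ∈ S) {c : I}
    (hc : v (box φ) < c) :
    ∃ h : CanonicalWorld v S, h.1 φ < canonicalPoss v h.1 ∧ h.1 φ < c := by
  classical
  have hmod : IsModalized (box φ) := ⟨φ, .inl rfl⟩
  obtain ⟨δ, hδ, hmin⟩ := ((rigidPart S).filter (v (box φ) < v ·)).exists_min_image v
    ⟨Formula.top, by simp [top_mem_rigidPart, hv.top, hc.trans_le unitInterval.le_one']⟩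
  rw [Finset.mem_filter] at hδ
  have hmin' (Y : Formula V) (hY : Y ∈ rigidPart S) (h : v (box φ) < v Y) : v δ ≤ v Y :=
    hmin Y (by simp [hY, h])
  obtain ⟨u, hu, huv, hlt⟩ := hv.exists_godelHom (φ := Formula.imp δ φ) (fun h =>
    absurd ((hv.isRigid_of_mem hδ.1).le_box.trans (hv.box_le_box h)) hδ.2.not_ge)
  rw [hu.imp, gimp_lt_one_iff] at hlt
  have hφ1 : u φ < 1 := hlt.trans_le unitInterval.le_one'
  have ha : u (box φ) ≤ u φ := hu.imp_eq_one_iff.1 (huv _ (hv.box_box_imp_self φ))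
  have hmono {X Y : Formula V} (hX : X ∈ rigidPart S) (hY : Y ∈ rigidPart S) :
      v X ≤ v Y → u X ≤ u Y :=
    hv.le_of_le hu huv (hv.isRigid_of_mem hX) (hv.isRigid_of_mem hY)
  have hbox := mem_rigidPart hφ hmod
  obtain ⟨f, hf, hf0, hfv, hf1, -⟩ := hv.exists_recover S hu huv
  have hfa : f (u (box φ)) = v (box φ) := hfv _ hbox (ha.trans_lt hφ1)
  have hle (Y : Formula V) (hY : Y ∈ rigidPart S) (h : u Y ≤ u φ) : v Y ≤ v (box φ) :=
    not_lt.1 fun h' => absurd (h.trans_lt hlt) (hmono hδ.1 hY (hmin' Y hY h')).not_gt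
  obtain ⟨g, hg, hgf, hgt⟩ := exists_strictMono_eqOn_between hf
    (Finset.mem_image.2 ⟨_, bot_mem_rigidPart S, hu.bot⟩)
    (Finset.mem_image.2 ⟨_, top_mem_rigidPart S, hu.top⟩) (t := u φ) hc
    (fun s hs hst => by
      obtain ⟨Y, hY, rfl⟩ := Finset.mem_image.1 hs
      rw [hfv Y hY (hst.trans hφ1)]
      exact (hle Y hY hst.le).trans_lt hc)
    (fun s hs hst => by
      rw [← hfa]
      exact hf (Finset.mem_image_of_mem _ hbox) hs (ha.trans_lt hst))
  obtain ⟨h, hpos, hlt', -⟩ := hu.exists_world S huv hf0 hfv hf1 hg hgf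
  refine ⟨h, ?_, ?_⟩
  · rw [hlt' φ hφ1]; exact (hg hφ1).trans_le hpos
  · rw [hlt' φ hφ1]
    by_cases ht : u φ ∈ (rigidPart S).image u
    · rw [hgf ht]
      obtain ⟨Y, hY, hYφ⟩ := Finset.mem_image.1 ht
      rw [← hYφ, hfv Y hY (hYφ ▸ hφ1)]
      exact (hle Y hY hYφ.le).trans_lt hc
    · exact (hgt ht).2

theorem IsK45Hom.exists_world_dia [Countable V] {φ : Formula V} (hφ : dia φ ∈ S) {c : I}
    (hc : c < v (dia φ)) :
    ∃ h : CanonicalWorld v S, c < canonicalPoss v h.1 ∧ c < h.1 φ := by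
  classical
  have hmod : IsModalized (dia φ) := ⟨φ, .inr rfl⟩
  obtain ⟨δ, hδ, hmax⟩ := ((rigidPart S).filter (v · < v (dia φ))).exists_max_image v
    ⟨Formula.bot, by simp [bot_mem_rigidPart, hv.bot, unitInterval.nonneg'.trans_lt hc]⟩
  rw [Finset.mem_filter] at hδ
  obtain ⟨u, hu, huv, hlt⟩ := hv.exists_godelHom (φ := Formula.imp φ δ) (fun h =>
    absurd ((hv.dia_le_dia h).trans (hv.isRigid_of_mem hδ.1).dia_le) hδ.2.not_ge)
  rw [hu.imp, gimp_lt_one_iff] at hlt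
  have ha : u φ ≤ u (dia φ) := hu.imp_eq_one_iff.1 (huv _ (hv.box_imp_dia_self φ))
  have hmono {X Y : Formula V} (hX : X ∈ rigidPart S) (hY : Y ∈ rigidPart S) :
      v X ≤ v Y → u X ≤ u Y :=
    hv.le_of_le hu huv (hv.isRigid_of_mem hX) (hv.isRigid_of_mem hY)
  have hdia := mem_rigidPart hφ hmod
  obtain ⟨f, hf, hf0, hfv, hf1, A, hA, hA1, hfA⟩ := hv.exists_recover S hu huv
  have hge (Y : Formula V) (hY : Y ∈ rigidPart S) (h : u φ ≤ u Y) : v (dia φ) ≤ v Y :=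
    not_lt.1 fun h' => absurd (hlt.trans_le h)
      (hmono hY hδ.1 (hmax Y (by simp [hY, h']))).not_gt
  have hfge (Y : Formula V) (hY : Y ∈ rigidPart S) (h : u φ ≤ u Y) : c < f (u Y) := by
    refine hc.trans_le ?_
    rcases lt_or_eq_of_le (unitInterval.le_one' : u Y ≤ 1) with h1 | h1
    · rw [hfv Y hY h1]; exact hge Y hY h
    · rw [h1, hfA]; exact hge A hA (hA1 ▸ unitInterval.le_one')
  obtain ⟨g, hg, hgf, hgt⟩ := exists_strictMono_eqOn_between hf
    (Finset.mem_image.2 ⟨_, bot_mem_rigidPart S, hu.bot⟩)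
    (Finset.mem_image.2 ⟨_, top_mem_rigidPart S, hu.top⟩) (t := u φ) hc
    (fun s hs hst => by
      obtain ⟨Y, hY, rfl⟩ := Finset.mem_image.1 hs
      rw [hfv Y hY (hst.trans_le unitInterval.le_one')]
      exact not_le.1 fun h => absurd ((hmono hdia hY h).trans_lt hst) ha.not_gt)
    (fun s hs hst => by
      obtain ⟨Y, hY, rfl⟩ := Finset.mem_image.1 hs
      exact hfge Y hY hst.le)
  have hgφ : c < g (u φ) := by
    by_cases ht : u φ ∈ (rigidPart S).image u
    · rw [hgf ht]
      obtain ⟨Y, hY, hYφ⟩ := Finset.mem_image.1 ht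
      rw [← hYφ]
      exact hfge Y hY hYφ.ge
    · exact (hgt ht).1
  have hg1 : c < g 1 := hgφ.trans_le (hg.monotone unitInterval.le_one')
  obtain ⟨h, hpos, hlt', hone⟩ := hu.exists_world S huv hf0 hfv hf1 hg hgf
  refine ⟨h, hg1.trans_le hpos, ?_⟩
  rcases lt_or_eq_of_le (unitInterval.le_one' : u φ ≤ 1) with h1 | h1
  · rwa [hlt' φ h1]
  · exact hg1.trans_le (hone φ h1)

end

instance [Countable V] (v : Formula V → I) (S : Finset (Formula V)) :
    Small.{w} (CanonicalWorld v S) :=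
  inferInstanceAs (Small.{w} {h : Formula V → I //
    IsGodelHom h ∧ ∀ X ∈ S, IsModalized X → h X = v X})

/-- The canonical model. -/
noncomputable def canonicalModel [Countable V] {v : Formula V → I} (hv : IsK45Hom v)
    (S : Finset (Formula V)) : PiModel.{u, w} V where
  World := Shrink.{w} (CanonicalWorld v S)
  nonempty := ⟨equivShrink _ ⟨v, hv.toIsGodelHom, fun _ _ _ => rfl⟩⟩
  poss y := canonicalPoss v ((equivShrink _).symm y).1
  val y p := ((equivShrink _).symm y).1 (.var p)

/-- The worlds of the canonical model, in their original universe. -/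
noncomputable def canonicalWorldEquiv [Countable V] {v : Formula V → I} (hv : IsK45Hom v)
    (S : Finset (Formula V)) : CanonicalWorld v S ≃ (canonicalModel.{u, w} hv S).World :=
  equivShrink _

theorem poss_canonicalWorldEquiv [Countable V] {v : Formula V → I} (hv : IsK45Hom v)
    (S : Finset (Formula V)) (x : CanonicalWorld v S) :
    (canonicalModel.{u, w} hv S).poss (canonicalWorldEquiv hv S x) = canonicalPoss v x.1 :=
  congrArg (fun y : CanonicalWorld v S => canonicalPoss v y.1) (Equiv.symm_apply_apply _ x)

theorem val_canonicalWorldEquiv [Countable V] {v : Formula V → I} (hv : IsK45Hom v)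
    (S : Finset (Formula V)) (x : CanonicalWorld v S) (p : V) :
    (canonicalModel.{u, w} hv S).val (canonicalWorldEquiv hv S x) p = x.1 (.var p) :=
  congrArg (fun y : CanonicalWorld v S => y.1 (.var p)) (Equiv.symm_apply_apply _ x)

/-- Closure under immediate subformulas. -/
structure SubformulaClosed (S : Set (Formula V)) : Prop where
  and (φ ψ : Formula V) : Formula.and φ ψ ∈ S → φ ∈ S ∧ ψ ∈ S
  imp (φ ψ : Formula V) : Formula.imp φ ψ ∈ S → φ ∈ S ∧ ψ ∈ S
  box (φ : Formula V) : Formula.box φ ∈ S → φ ∈ S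
  dia (φ : Formula V) : Formula.dia φ ∈ S → φ ∈ S

theorem exists_subformulaClosed_of_mem (φ : Formula V) :
    ∃ S : Set (Formula V), S.Finite ∧ SubformulaClosed S ∧ φ ∈ S := by
  have binary {φ ψ χ : Formula V} {S R : Set (Formula V)} (hS : SubformulaClosed S)
      (hR : SubformulaClosed R) (hφ : φ ∈ S) (hψ : ψ ∈ R)
      (hχ : χ = .and φ ψ ∨ χ = .imp φ ψ ∨ χ = .box φ ∨ χ = .dia φ) :
      SubformulaClosed (insert χ (S ∪ R)) := by
    refine ⟨fun a b h => ?_, fun a b h => ?_, fun a h => ?_, fun a h => ?_⟩ <;>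
    rcases h with h | h | h
    · subst h; simp at hχ; simp [hχ.1, hχ.2, hφ, hψ]
    · have := hS.and _ _ h; simp [this.1, this.2]
    · have := hR.and _ _ h; simp [this.1, this.2]
    · subst h; simp at hχ; simp [hχ.1, hχ.2, hφ, hψ]
    · have := hS.imp _ _ h; simp [this.1, this.2]
    · have := hR.imp _ _ h; simp [this.1, this.2]
    · subst h; simp at hχ; simp [hχ, hφ]
    · have := hS.box _ h; simp [this]
    · have := hR.box _ h; simp [this]
    · subst h; simp at hχ; simp [hχ, hφ]
    · have := hS.dia _ h; simp [this]
    · have := hR.dia _ h; simp [this]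
  induction φ with
  | var p => exact ⟨{.var p}, by simp, ⟨by simp, by simp, by simp, by simp⟩, rfl⟩
  | bot => exact ⟨{.bot}, by simp, ⟨by simp, by simp, by simp, by simp⟩, rfl⟩
  | and φ ψ ih₁ ih₂ =>
    obtain ⟨S, hS, hS', hφ⟩ := ih₁
    obtain ⟨R, hR, hR', hψ⟩ := ih₂
    exact ⟨_, (hS.union hR).insert _, binary hS' hR' hφ hψ (by simp), .inl rfl⟩
  | imp φ ψ ih₁ ih₂ =>
    obtain ⟨S, hS, hS', hφ⟩ := ih₁
    obtain ⟨R, hR, hR', hψ⟩ := ih₂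
    exact ⟨_, (hS.union hR).insert _, binary hS' hR' hφ hψ (.inr (.inl rfl)), .inl rfl⟩
  | box φ ih =>
    obtain ⟨S, hS, hS', hφ⟩ := ih
    exact ⟨_, (hS.union hS).insert _, binary hS' hS' hφ hφ (.inr (.inr (.inl rfl))), .inl rfl⟩
  | dia φ ih =>
    obtain ⟨S, hS, hS', hφ⟩ := ih
    exact ⟨_, (hS.union hS).insert _, binary hS' hS' hφ hφ (.inr (.inr (.inr rfl))), .inl rfl⟩

theorem exists_subformulaClosed_superset {T : Set (Formula V)} (hT : T.Finite) :
    ∃ S : Finset (Formula V), SubformulaClosed (S : Set (Formula V)) ∧ T ⊆ S := by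
  choose F hF hF' hmem using fun φ : Formula V => exists_subformulaClosed_of_mem φ
  have hfin : (⋃ φ ∈ T, F φ).Finite := hT.biUnion fun φ _ => hF φ
  refine ⟨hfin.toFinset, ?_, fun φ hφ => ?_⟩
  · rw [hfin.coe_toFinset]
    refine ⟨fun a b h => ?_, fun a b h => ?_, fun a h => ?_, fun a h => ?_⟩ <;>
    simp only [Set.mem_iUnion] at h ⊢ <;> obtain ⟨χ, hχ, h⟩ := h
    · exact ⟨⟨χ, hχ, ((hF' χ).and a b h).1⟩, ⟨χ, hχ, ((hF' χ).and a b h).2⟩⟩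
    · exact ⟨⟨χ, hχ, ((hF' χ).imp a b h).1⟩, ⟨χ, hχ, ((hF' χ).imp a b h).2⟩⟩
    · exact ⟨χ, hχ, (hF' χ).box a h⟩
    · exact ⟨χ, hχ, (hF' χ).dia a h⟩
  · rw [hfin.coe_toFinset]
    exact Set.mem_biUnion hφ (hmem φ)

/-- The truth lemma. -/
theorem eval_canonicalModel [Countable V] {v : Formula V → I} (hv : IsK45Hom v)
    {S : Finset (Formula V)} (hS : SubformulaClosed (S : Set (Formula V))) (φ : Formula V)
    (hφ : φ ∈ S) (x : CanonicalWorld v S) :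
    (canonicalModel.{u, w} hv S).eval (canonicalWorldEquiv hv S x) φ = x.1 φ := by
  induction φ generalizing x with
  | var p => rw [PiModel.eval, val_canonicalWorldEquiv]
  | bot => rw [PiModel.eval, x.2.1.bot]
  | and φ ψ ih₁ ih₂ =>
    have h := hS.and φ ψ hφ
    rw [PiModel.eval, ih₁ h.1, ih₂ h.2, x.2.1.and]
  | imp φ ψ ih₁ ih₂ =>
    have h := hS.imp φ ψ hφ
    rw [PiModel.eval, ih₁ h.1, ih₂ h.2, x.2.1.imp]
  | box φ ih =>
    have hval (y : CanonicalWorld v S) : y.1 (box φ) = v (box φ) :=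
      y.2.2 _ hφ ⟨φ, .inl rfl⟩
    have ih := ih (hS.box φ hφ)
    rw [hval]
    apply le_antisymm
    · refine le_of_forall_gt_imp_ge_of_dense fun c hc => ?_
      obtain ⟨h, hpos, hlt⟩ := hv.exists_world_box S hφ hc
      have h1 := (canonicalModel.{u, w} hv S).eval_box_le (canonicalWorldEquiv hv S x)
        (canonicalWorldEquiv hv S h) φ
      rw [ih, poss_canonicalWorldEquiv] at h1
      rcases min_le_iff.1 h1 with h3 | h3
      · exact h3.trans hlt.le
      · exact absurd hpos h3.not_gt
    · refine PiModel.le_eval_box _ _ _ _ fun y => ?_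
      obtain ⟨y, rfl⟩ := (canonicalWorldEquiv hv S).surjective y
      rw [ih y, poss_canonicalWorldEquiv]
      have hle := canonicalPoss_le (h := y.1) (hv.box_box_imp_self φ)
      rwa [y.2.1.imp, hval, le_gimp_iff, min_comm] at hle
  | dia φ ih =>
    have hval (y : CanonicalWorld v S) : y.1 (dia φ) = v (dia φ) :=
      y.2.2 _ hφ ⟨φ, .inr rfl⟩
    have ih := ih (hS.dia φ hφ)
    rw [hval]
    apply le_antisymm
    · refine PiModel.eval_dia_le _ _ _ _ fun y => ?_
      obtain ⟨y, rfl⟩ := (canonicalWorldEquiv hv S).surjective y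
      rw [ih y, poss_canonicalWorldEquiv]
      have hle := canonicalPoss_le (h := y.1) (hv.box_imp_dia_self φ)
      rwa [y.2.1.imp, hval, le_gimp_iff] at hle
    · refine le_of_forall_lt_imp_le_of_dense fun c hc => ?_
      obtain ⟨h, hpos, hlt⟩ := hv.exists_world_dia S hφ hc
      have h1 := (canonicalModel.{u, w} hv S).le_eval_dia (canonicalWorldEquiv hv S x)
        (canonicalWorldEquiv hv S h) φ
      rw [ih, poss_canonicalWorldEquiv] at h1
      exact (le_min hpos.le hlt.le).trans h1

theorem derives_of_piEntails [Countable V] {T : Set (Formula V)} (hT : T.Finite) {φ : Formula V}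
    (h : PiEntails.{u, w} T φ) : DerivesK45 T φ := by
  by_contra hn
  obtain ⟨v, hv, hT1, hφ⟩ := exists_godelHom_of_not_derives hn
  have hv' : IsK45Hom v := ⟨hv, fun χ hχ => hT1 χ (hχ.mono (Set.empty_subset T))⟩
  obtain ⟨S, hS, hTS⟩ := exists_subformulaClosed_superset (hT.insert φ)
  let y : CanonicalWorld v S := ⟨v, hv, fun _ _ _ => rfl⟩
  have key (ψ : Formula V) (hψ : ψ ∈ insert φ T) :
      (canonicalModel.{u, w} hv' S).eval (canonicalWorldEquiv hv' S y) ψ = v ψ := by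
    rw [eval_canonicalModel hv' hS ψ (hTS hψ)]
  have := h (canonicalModel hv' S) (canonicalWorldEquiv hv' S y)
    fun ψ hψ => (key ψ (.inr hψ)).trans (hT1 ψ (.hyp hψ))
  rw [key φ (.inl rfl)] at this
  exact hφ.ne this

end GodelModal

theorem theorem2 {V : Type u} [Countable V] (T : Set (GodelModal.Formula V)) (hT : T.Finite)
    (φ : GodelModal.Formula V) :
    GodelModal.PiEntails.{u, w} T φ ↔ GodelModal.DerivesK45 T φ :=
  ⟨GodelModal.derives_of_piEntails hT, GodelModal.DerivesK45.sound⟩
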